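/- A family $\mathcal{A}$ of subsets of $\mathbb{Z}$ is called a Sidon system if its twofold sumsets are pairwise distinct, i.e. for all $A,B,C,D\in\mathcal{A}$, $A+B=C+D$ implies $\{A,B\}=\{C,D\}$, where $A+B=\{a+b : a\in A,\ b\in B\}$. Fix an integer $k\ge 2$ and let $p=p(N)\in[0,1]$ be a sequence of probabilities. For each $N$, let $\mathcal{A}$ be the random family of $k$-element subsets of $[N]=\{1,\dots,N\}$ obtained by including each of the $\binom{N}{k}$ $k$-subsets independently with probability $p(N)$. Then $$\lim_{N\to\infty}\Pr(\mathcal{A}\text{ is a Sidon system})=\begin{cases}1, & \text{if } p=o\bigl(N^{-(2k+1)/4}\bigr),\\ 0, & \text{if } p=\omega\bigl(N^{-(2k+1)/4}\bigr),\end{cases}$$ where $p=\omega(f)$ means $f=o(p)$ as $N\to\infty$. -/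

import Mathlib

open scoped Pointwise Asymptotics

/-- A family `(A i)` of sets of integers, indexed by `ι`, is a *Sidon system* if the sumsets
`A i + A j` are pairwise distinct, up to the order of the two summands. -/
def IsSidonSystem {ι : Type*} (A : ι → Set ℤ) : Prop :=
  ∀ i j i' j' : ι, A i + A j = A i' + A j' → ({i, j} : Set ι) = {i', j'}

/-- The family of all `k`-element subsets of `[N] = {1, …, N}`. -/
def kSubsets (N k : ℕ) : Set (Finset ℤ) :=
  (Finset.powersetCard k (Finset.Icc (1 : ℤ) (N : ℤ)) : Finset (Finset ℤ))

/-- The law of the random set system that contains each `k`-element subset of `[N]`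
independently with probability `p`, and no other set. -/
noncomputable def randomSystem (N k : ℕ) (p : unitInterval) :
    MeasureTheory.Measure (Set (Finset ℤ)) :=
  ProbabilityTheory.setBernoulli (kSubsets N k) p

/-- The event that a set system, indexed by its own members, is a Sidon system. -/
def sidonEvent : Set (Set (Finset ℤ)) :=
  {𝒜 | IsSidonSystem (fun A : 𝒜 => ((A : Finset ℤ) : Set ℤ))}

/-! ### First and second moment bounds for containment events -/

section Probability

open MeasureTheory ProbabilityTheory

variable {α ι : Type*}

/-! Write r = p N^((2k+1)/4). Given A, B and one element c of C, the relation A + B = C + D leaves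
boundedly many (C, D), since C and D lie in translates of A + B. Hence there are O(N^(2k+1)) such
quadruples, and those with four distinct members have expected number O(r^4) in the random family.

For small r, coincidences among the four sets must also be controlled. The delicate relation is A +
B = A + D with B ≠ D, where the naive count N^(2k) is too large; a functional-graph argument
(`card_solutions_le`) gives N^(k + k/2). All degenerate relations then contribute O(r^3) or O(r^2),
and a union bound finishes.

For large r, the translates A, t + A, B', t + B' satisfy A + (t + B') = (t + A) + B'. There are
about N^(2k+1) of them, so their expected number is of order r^4. Keeping A and B' in separated
intervals makes the pair correlations factor, and Chebyshev's inequality shows that some quadruple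
is present with probability tending to 1. -/

lemma measurableSet_superset (F : Finset α) : MeasurableSet {s : Set α | (F : Set α) ⊆ s} := by
  have : {s : Set α | (F : Set α) ⊆ s} = ⋂ a ∈ F, {s : Set α | a ∈ s} := by
    ext s; simp [Set.subset_def]
  rw [this]
  exact F.measurableSet_biInter fun a _ => measurableSet_setOfPred.2 (measurable_set_mem a)

lemma setBernoulli_real_superset (u : Set α) (p : unitInterval) (F : Finset α)
    (hF : (F : Set α) ⊆ u) :
    (setBernoulli u p).real {s | (F : Set α) ⊆ s} = (p : ℝ) ^ F.card := by
  have : (fun p : α → Prop ↦ {i | p i}) ⁻¹' {s | (F : Set α) ⊆ s} =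
      Set.pi (F : Set α) (fun _ => {True}) := by
    ext s; simp [Set.subset_def, Set.mem_pi]
  rw [measureReal_def, setBernoulli_apply', this, Measure.infinitePi_pi _ (by simp),
    Finset.prod_congr rfl (g := fun _ => (unitInterval.toNNReal p : ENNReal))]
  · simp
  · intro i hi
    have := hF hi
    simp [this]

/-- First moment bound. -/
lemma setBernoulli_real_exists_superset_le (u : Set α) (p : unitInterval) (T : Finset ι)
    (q : ι → Finset α) (hq : ∀ i ∈ T, (q i : Set α) ⊆ u) (r : ℕ) (hr : ∀ i ∈ T, (q i).card = r) :
    (setBernoulli u p).real {s | ∃ i ∈ T, (q i : Set α) ⊆ s} ≤ T.card * (p : ℝ) ^ r := by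
  have : {s | ∃ i ∈ T, (q i : Set α) ⊆ s} = ⋃ i ∈ T, {s | (q i : Set α) ⊆ s} := by
    ext s; simp
  rw [this]
  refine (measureReal_biUnion_finset_le _ _).trans ?_
  rw [← nsmul_eq_mul, ← Finset.sum_const]
  refine Finset.sum_le_sum fun i hi => ?_
  rw [setBernoulli_real_superset u p _ (hq i hi), hr i hi]

/-- Second moment bound. -/
lemma setBernoulli_real_forall_not_superset_le [DecidableEq α] (u : Set α) (p : unitInterval)
    (T : Finset ι) (q : ι → Finset α) (hq : ∀ i ∈ T, (q i : Set α) ⊆ u) {μ V : ℝ} (hμ : 0 < μ)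
    (hμq : ∑ i ∈ T, (p : ℝ) ^ (q i).card = μ)
    (hV : ∑ i ∈ T, ∑ j ∈ T, (p : ℝ) ^ (q i ∪ q j).card ≤ V) :
    (setBernoulli u p).real {s | ∀ i ∈ T, ¬ (q i : Set α) ⊆ s} ≤ V / μ ^ 2 - 1 := by
  set P := setBernoulli u p
  let f : ι → Set α → ℝ := fun i => Set.indicator {s | (q i : Set α) ⊆ s} 1
  have hms : ∀ F : Finset α, MeasurableSet {s : Set α | (F : Set α) ⊆ s} := measurableSet_superset
  have hint : ∀ F : Finset α, Integrable (Set.indicator {s : Set α | (F : Set α) ⊆ s}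
      (1 : Set α → ℝ)) P := fun F => (integrable_const 1).indicator (hms F)
  have hval : ∀ F : Finset α, (F : Set α) ⊆ u →
      ∫ s, Set.indicator {s : Set α | (F : Set α) ⊆ s} (1 : Set α → ℝ) s ∂P = (p : ℝ) ^ F.card := by
    intro F hF
    rw [integral_indicator_one (hms F)]
    exact setBernoulli_real_superset u p F hF
  let X : Set α → ℝ := fun s => ∑ i ∈ T, f i s
  have hff : ∀ i j s, f i s * f j s =
      Set.indicator {s : Set α | ((q i ∪ q j : Finset α) : Set α) ⊆ s} (1 : Set α → ℝ) s := by
    intro i j s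
    simp only [f, Set.indicator, Set.mem_ofPred_eq, Finset.coe_union, Set.union_subset_iff]
    split_ifs <;> simp_all
  have hX2 : ∀ s, X s ^ 2 = ∑ i ∈ T, ∑ j ∈ T,
      Set.indicator {s : Set α | ((q i ∪ q j : Finset α) : Set α) ⊆ s} (1 : Set α → ℝ) s := by
    intro s
    simp only [X, sq, Finset.sum_mul_sum, hff]
  have hXi : Integrable X P := integrable_finsetSum _ fun i _ => hint _
  have hX2i : Integrable (fun s => X s ^ 2) P := by
    simp only [hX2]
    exact integrable_finsetSum _ fun i _ => integrable_finsetSum _ fun j _ => hint _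
  have hEX : ∫ s, X s ∂P = μ := by
    rw [← hμq, integral_finsetSum _ fun i _ => hint _]
    exact Finset.sum_congr rfl fun i hi => hval _ (hq i hi)
  have hEX2 : ∫ s, X s ^ 2 ∂P ≤ V := by
    simp only [hX2]
    rw [integral_finsetSum _ fun i _ => integrable_finsetSum _ fun j _ => hint _]
    refine le_trans (le_of_eq (Finset.sum_congr rfl fun i hi => ?_)) hV
    rw [integral_finsetSum _ fun j _ => hint _]
    refine Finset.sum_congr rfl fun j hj => hval _ ?_
    simpa using ⟨hq i hi, hq j hj⟩
  have hM : ∫ s, (X s - μ) ^ 2 ∂P ≤ V - μ ^ 2 := by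
    have : ∀ s, (X s - μ) ^ 2 = X s ^ 2 - 2 * μ * X s + μ ^ 2 := fun s => by ring
    simp only [this]
    have hd : Integrable (fun s => X s ^ 2 - 2 * μ * X s) P := hX2i.sub (hXi.const_mul _)
    rw [integral_add hd (integrable_const _), integral_sub hX2i (hXi.const_mul _),
      integral_const_mul, hEX]
    simp
    nlinarith
  have hi2 : Integrable (fun s => (X s - μ) ^ 2) P := by
    have : ∀ s, (X s - μ) ^ 2 = X s ^ 2 - 2 * μ * X s + μ ^ 2 := fun s => by ring
    simp only [this]
    exact (hX2i.sub (hXi.const_mul _)).add (integrable_const _)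
  -- Chebyshev: Markov for (X - μ)^2 at level μ^2, the value taken where X = 0.
  have hmarkov := mul_meas_ge_le_integral_of_nonneg (μ := P)
    (Filter.Eventually.of_forall fun s => sq_nonneg (X s - μ)) hi2 (μ ^ 2)
  have hsub : P.real {s | ∀ i ∈ T, ¬ (q i : Set α) ⊆ s} ≤ P.real {s | μ ^ 2 ≤ (X s - μ) ^ 2} := by
    refine measureReal_mono fun s hs => ?_
    have : X s = 0 := Finset.sum_eq_zero fun i hi => by
      simp only [f]
      exact Set.indicator_of_notMem (hs i hi) _
    simp [this]
  have h2 : 0 < μ ^ 2 := by positivity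
  rw [le_sub_iff_add_le, le_div_iff₀ h2]
  nlinarith

end Probability

/-! ### Counting coincidences of sumsets -/

section Counting

/-- The number of components of the functional graph of a fixed-point-free map is at most half of
the number of its vertices. -/
lemma exists_representatives {ι : Type*} [Fintype ι] (f : ι → ι) (hf : ∀ i, f i ≠ i) :
    ∃ R : Finset ι, 2 * R.card ≤ Fintype.card ι ∧
      ∀ z : ι → ℤ, (∀ i, z (f i) = z i) → (∀ i ∈ R, z i = 0) → ∀ i, z i = 0 := by
  classical
  let s : Setoid ι := Relation.EqvGen.setoid fun i j => f i = j
  have hs : ∀ i, s.r i (f i) := fun i => Relation.EqvGen.rel _ _ rfl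
  refine ⟨Finset.univ.image (Quotient.out : Quotient s → ι), ?_, ?_⟩
  · rw [Finset.card_image_of_injective _ Quotient.out_injective]
    refine Finset.mul_card_image_le_card_of_maps_to (s := (Finset.univ : Finset ι))
      (f := fun i => (⟦i⟧ : Quotient s)) (fun _ _ => Finset.mem_univ _) 2 fun c _ => ?_
    -- Each class contains its representative and the image of that representative, which is a
    -- different point.
    rw [← Nat.lt_iff_add_one_le, Finset.one_lt_card]
    refine ⟨c.out, by simp, f c.out, ?_, (hf _).symm⟩
    have : (⟦f c.out⟧ : Quotient s) = ⟦c.out⟧ := Quotient.sound (s.symm (hs _))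
    simp [this]
  · intro z hz hR i
    have key : ∀ i j, Relation.EqvGen (fun i j => f i = j) i j → z i = z j := by
      intro i j h
      induction h with
      | rel x y h => rw [← h, hz]
      | refl x => rfl
      | symm x y _ ih => exact ih.symm
      | trans x y w _ _ h1 h2 => exact h1.trans h2
    have h1 : s.r (Quotient.out (⟦i⟧ : Quotient s)) i := Quotient.exact (Quotient.out_eq _)
    rw [← key _ _ h1]
    exact hR _ (by simp)

/-- A function on a finite type cannot grow by a positive constant along a self-map. -/
lemma eq_zero_of_apply_eq_add {ι : Type*} [Finite ι] [Nonempty ι] (f : ι → ι) (z : ι → ℤ) (β : ℤ)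
    (h : ∀ i, z (f i) = z i + β) : β = 0 := by
  obtain ⟨i, hi⟩ := Finite.exists_max z
  obtain ⟨j, hj⟩ := Finite.exists_min z
  have := hi (f i)
  have := hj (f j)
  have := h i
  have := h j
  omega

/-- For fixed y, the difference z of two solutions x satisfies z (f i) = z i + β, so β = 0 and z is
constant on the components of f. Thus y and the values of x at representatives determine everything,
b included. -/
lemma card_solutions_le {ι : Type*} [Fintype ι] [DecidableEq ι] [Nonempty ι] (f g : ι → ι)
    (hf : ∀ i, f i ≠ i) (I : Finset ℤ) (hI : I.Nonempty) :
    (((Fintype.piFinset fun _ : ι => I) ×ˢ (Fintype.piFinset fun _ : ι => I) ×ˢ I).filter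
      fun w => ∀ i, w.1 i + w.2.2 = w.1 (f i) + w.2.1 (g i)).card ≤
      I.card ^ (Fintype.card ι + Fintype.card ι / 2) := by
  obtain ⟨R, hR, hz⟩ := exists_representatives f hf
  calc _ ≤ ((Fintype.piFinset fun _ : R => I) ×ˢ (Fintype.piFinset fun _ : ι => I)).card := by
        refine Finset.card_le_card_of_injOn (fun w => (fun i => w.1 i, w.2.1)) ?_ ?_
        · intro w hw
          simp only [Finset.coe_filter, Finset.mem_product, Fintype.mem_piFinset,
            Set.mem_ofPred_eq] at hw
          simp only [Finset.coe_product, Set.mem_prod, Finset.mem_coe, Fintype.mem_piFinset]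
          exact ⟨fun i => hw.1.1 i, hw.1.2.1⟩
        · rintro ⟨x, y, b⟩ hw ⟨x', y', b'⟩ hw' h
          simp only [Finset.coe_filter, Set.mem_ofPred_eq] at hw hw'
          simp only [Prod.mk.injEq] at h
          obtain ⟨hx, rfl⟩ := h
          have h1 : ∀ i, (x - x') (f i) = (x - x') i + (b - b') := fun i => by
            have := hw.2 i
            have := hw'.2 i
            simp only [Pi.sub_apply]
            omega
          have hb : b = b' := sub_eq_zero.1 (eq_zero_of_apply_eq_add f _ _ h1)
          have hxx : x = x' := by
            funext i
            refine sub_eq_zero.1 (hz (x - x') (fun i => by rw [h1, hb]; simp) ?_ i)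
            intro i hi
            exact sub_eq_zero.2 (congrFun hx ⟨i, hi⟩)
          rw [hb, hxx]
    _ = I.card ^ (R.card + Fintype.card ι) := by
        simp [pow_add]
    _ ≤ _ := Nat.pow_le_pow_right hI.card_pos (by omega)

variable {k : ℕ}

lemma card_add_le_sq {A B : Finset ℤ} (hA : A.card = k) (hB : B.card = k) :
    (A + B).card ≤ k ^ 2 := by
  rw [sq]
  exact (Finset.card_add_le).trans (by rw [hA, hB])

/-- A summand is contained in a translate of the sumset. -/
lemma subset_image_sub_of_mem {C D S : Finset ℤ} (h : C + D = S) {d : ℤ} (hd : d ∈ D) :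
    C ⊆ S.image (· - d) := fun c hc =>
  Finset.mem_image.2 ⟨c + d, h ▸ Finset.add_mem_add hc hd, by ring⟩

/-- Take b in B but not in D and write each a + b as a' + d. If a' = a then d = b would lie in D, so
a ↦ a' has no fixed point. -/
lemma exists_encoding_of_ne {A B D : Finset ℤ} (hA : A.card = k) (hB : B.card = k)
    (hD : D.card = k) (h : A + B = A + D) (hne : B ≠ D) :
    ∃ (f g : Fin k → Fin k) (x y : Fin k → ℤ) (b : ℤ), (∀ i, f i ≠ i) ∧ b ∈ B ∧
      Finset.univ.image x = A ∧ Finset.univ.image y = D ∧ ∀ i, x i + b = x (f i) + y (g i) := by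
  obtain ⟨b, hb, hbD⟩ : ∃ b ∈ B, b ∉ D := by
    by_contra! hc
    exact hne (Finset.eq_of_subset_of_card_le hc (by omega))
  let ex := (A.orderIsoOfFin hA)
  let ey := (D.orderIsoOfFin hD)
  have key : ∀ i, ∃ i' j, (ex i : ℤ) + b = ex i' + ey j := by
    intro i
    have : (ex i : ℤ) + b ∈ A + D := h ▸ Finset.add_mem_add (ex i).2 hb
    obtain ⟨a, ha, d, hd, had⟩ := Finset.mem_add.1 this
    exact ⟨ex.symm ⟨a, ha⟩, ey.symm ⟨d, hd⟩, by simp [had]⟩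
  choose f g hfg using key
  refine ⟨f, g, fun i => ex i, fun i => ey i, b, fun i hi => hbD ?_, hb, ?_, ?_, hfg⟩
  · have := hfg i
    rw [hi] at this
    rw [add_left_cancel this]
    exact (ey _).2
  · ext a
    simp only [Finset.mem_image, Finset.mem_univ, true_and]
    exact ⟨fun ⟨i, hi⟩ => hi ▸ (ex i).2, fun ha => ⟨ex.symm ⟨a, ha⟩, by simp⟩⟩
  · ext a
    simp only [Finset.mem_image, Finset.mem_univ, true_and]
    exact ⟨fun ⟨i, hi⟩ => hi ▸ (ey i).2, fun ha => ⟨ey.symm ⟨a, ha⟩, by simp⟩⟩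

lemma card_powersetCard_le_pow (I : Finset ℤ) (k : ℕ) :
    (Finset.powersetCard k I).card ≤ I.card ^ k := by
  rw [Finset.card_powersetCard]
  exact Nat.choose_le_pow _ _

lemma card_powerset_image_le {S : Finset ℤ} (hS : S.card ≤ k ^ 2) (f : ℤ → ℤ) :
    (S.image f).powerset.card ≤ 2 ^ k ^ 2 := by
  rw [Finset.card_powerset]
  exact Nat.pow_le_pow_right two_pos (Finset.card_image_le.trans hS)

/-- The triples `(A, B, D)` with `A + B = A + D` and `B ≠ D`. -/
lemma card_add_left_eq_le (hk : k ≠ 0) (I : Finset ℤ) (hI : I.Nonempty) :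
    ((Finset.powersetCard k I ×ˢ Finset.powersetCard k I ×ˢ Finset.powersetCard k I).filter
      fun w => w.1 + w.2.1 = w.1 + w.2.2 ∧ w.2.1 ≠ w.2.2).card ≤
      2 ^ k ^ 2 * ((k ^ k) ^ 2 * I.card ^ (k + k / 2)) := by
  classical
  set T := ((Finset.powersetCard k I ×ˢ Finset.powersetCard k I ×ˢ Finset.powersetCard k I).filter
      fun w => w.1 + w.2.1 = w.1 + w.2.2 ∧ w.2.1 ≠ w.2.2) with hT
  have hmem : ∀ w, w ∈ T ↔ ((w.1 ⊆ I ∧ w.1.card = k) ∧ (w.2.1 ⊆ I ∧ w.2.1.card = k) ∧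
      (w.2.2 ⊆ I ∧ w.2.2.card = k)) ∧ w.1 + w.2.1 = w.1 + w.2.2 ∧ w.2.1 ≠ w.2.2 := by
    intro w
    simp [hT, Finset.mem_powersetCard]
  have : Nonempty (Fin k) := ⟨⟨0, Nat.pos_of_ne_zero hk⟩⟩
  let Sol : ((Fin k → Fin k) × (Fin k → Fin k)) → Finset ((Fin k → ℤ) × (Fin k → ℤ) × ℤ) :=
    fun fg => ((Fintype.piFinset fun _ : Fin k => I) ×ˢ
      (Fintype.piFinset fun _ : Fin k => I) ×ˢ I).filter
      fun w => ∀ i, w.1 i + w.2.2 = w.1 (fg.1 i) + w.2.1 (fg.2 i)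
  let G := (Finset.univ : Finset ((Fin k → Fin k) × (Fin k → Fin k))).filter
    fun fg => ∀ i, fg.1 i ≠ i
  let U : Finset (Finset ℤ × Finset ℤ) :=
    (G.biUnion Sol).image fun w => (Finset.univ.image w.1, Finset.univ.image w.2.1)
  have hU : U.card ≤ (k ^ k) ^ 2 * I.card ^ (k + k / 2) := by
    refine Finset.card_image_le.trans ((Finset.card_biUnion_le_card_mul G Sol
      (I.card ^ (k + k / 2)) fun fg hfg => ?_).trans ?_)
    · have h := card_solutions_le fg.1 fg.2 (Finset.mem_filter.1 hfg).2 I hI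
      rw [Fintype.card_fin] at h
      convert h
    · refine Nat.mul_le_mul_right _ ((Finset.card_filter_le _ _).trans ?_)
      simp [sq]
  -- The pairs (A, D) come from the encoded solutions; given such a pair, B is a subset of A + D -
  -- a.
  calc T.card ≤ 2 ^ k ^ 2 * U.card := by
        refine Finset.card_le_mul_card_image_of_maps_to (f := fun w => (w.1, w.2.2)) ?_ _ ?_
        · intro w hw
          obtain ⟨⟨⟨hAI, hA⟩, ⟨hBI, hB⟩, ⟨hDI, hD⟩⟩, h, hne⟩ := (hmem w).1 hw
          obtain ⟨f, g, x, y, b, hf, hb, hx, hy, hfg⟩ := exists_encoding_of_ne hA hB hD h hne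
          refine Finset.mem_image.2 ⟨(x, y, b), ?_, by simp only [hx, hy]⟩
          refine Finset.mem_biUnion.2 ⟨(f, g), by simpa [G] using hf, ?_⟩
          simp only [Sol, Finset.mem_filter, Finset.mem_product, Fintype.mem_piFinset]
          refine ⟨⟨fun i => hAI ?_, fun i => hDI ?_, hBI hb⟩, hfg⟩
          · rw [← hx]; exact Finset.mem_image_of_mem _ (Finset.mem_univ _)
          · rw [← hy]; exact Finset.mem_image_of_mem _ (Finset.mem_univ _)
        · rintro ⟨A, D⟩ -
          rcases ((T.filter fun w => (w.1, w.2.2) = (A, D))).eq_empty_or_nonempty with he | ⟨w, hw⟩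
          · rw [he]; simp
          obtain ⟨hw, hwe⟩ := Finset.mem_filter.1 hw
          obtain ⟨⟨⟨hAI, hA⟩, -, ⟨hDI, hD⟩⟩, -⟩ := (hmem w).1 hw
          simp only [Prod.mk.injEq] at hwe
          rw [hwe.1] at hA
          rw [hwe.2] at hD
          obtain ⟨a, ha⟩ : A.Nonempty := Finset.card_pos.1 (by omega)
          refine le_trans (Finset.card_le_card_of_injOn (fun w => w.2.1)
            (t := ((A + D).image (· - a)).powerset) ?_ ?_)
            (card_powerset_image_le (card_add_le_sq hA hD) _)
          · intro w hw
            obtain ⟨hw, hwe⟩ := Finset.mem_filter.1 (Finset.mem_coe.1 hw)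
            simp only [Prod.mk.injEq] at hwe
            have h := ((hmem w).1 hw).2.1
            rw [hwe.1, hwe.2, add_comm] at h
            exact Finset.mem_coe.2 (Finset.mem_powerset.2 (subset_image_sub_of_mem h ha))
          · intro w hw w' hw' heq
            obtain ⟨hw, hwe⟩ := Finset.mem_filter.1 (Finset.mem_coe.1 hw)
            obtain ⟨hw', hwe'⟩ := Finset.mem_filter.1 (Finset.mem_coe.1 hw')
            simp only [Prod.mk.injEq] at hwe hwe'
            exact Prod.ext (hwe.1.trans hwe'.1.symm)
              (Prod.ext heq (hwe.2.trans hwe'.2.symm))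
    _ ≤ _ := Nat.mul_le_mul_left _ hU

/-- The pairs `(C, D)` with a prescribed sumset and a prescribed element of `C`. -/
lemma card_add_eq_le {S : Finset ℤ} (hS : S.card ≤ k ^ 2) (c : ℤ) (T : Finset (Finset ℤ × Finset ℤ))
    (hT : ∀ w ∈ T, w.1 + w.2 = S ∧ c ∈ w.1 ∧ w.2.Nonempty) :
    T.card ≤ k ^ 2 * (2 ^ k ^ 2 * 2 ^ k ^ 2) := by
  -- Any d in D lies in S - c; once d is chosen, C ⊆ S - d and D ⊆ S - c.
  let V := (S.image (· - c)).biUnion fun d =>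
    (S.image (· - d)).powerset ×ˢ (S.image (· - c)).powerset
  have hTV : T ⊆ V := by
    rintro ⟨C, D⟩ hw
    obtain ⟨h, hc, d, hd⟩ := hT _ hw
    have hD : D ⊆ S.image (· - c) := subset_image_sub_of_mem (by rw [add_comm]; exact h) hc
    exact Finset.mem_biUnion.2 ⟨d, hD hd, Finset.mem_product.2
      ⟨Finset.mem_powerset.2 (subset_image_sub_of_mem h hd), Finset.mem_powerset.2 hD⟩⟩
  refine (Finset.card_le_card hTV).trans ((Finset.card_biUnion_le_card_mul _ _ _
    fun d _ => ?_).trans (Nat.mul_le_mul_right _ (Finset.card_image_le.trans hS)))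
  rw [Finset.card_product]
  exact Nat.mul_le_mul (card_powerset_image_le hS _) (card_powerset_image_le hS _)

/-- The quadruples with `A + B = C + D`. -/
lemma card_add_eq_add_le (hk : k ≠ 0) (I : Finset ℤ) :
    ((Finset.powersetCard k I ×ˢ Finset.powersetCard k I ×ˢ Finset.powersetCard k I ×ˢ
      Finset.powersetCard k I).filter fun w => w.1 + w.2.1 = w.2.2.1 + w.2.2.2).card ≤
      k ^ 2 * (2 ^ k ^ 2 * 2 ^ k ^ 2) * I.card ^ (2 * k + 1) := by
  classical
  set K := Finset.powersetCard k I with hK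
  have hKc : K.card ≤ I.card ^ k := card_powersetCard_le_pow I k
  have hne : ∀ C ∈ K, C.Nonempty := fun C hC =>
    Finset.card_pos.1 (by have := (Finset.mem_powersetCard.1 hC).2; omega)
  set T := (K ×ˢ K ×ˢ K ×ˢ K).filter fun w => w.1 + w.2.1 = w.2.2.1 + w.2.2.2 with hT
  -- A, B and one element c of C cost k + k + 1 powers of |I|.
  have hsub : T ⊆ (K ×ˢ K ×ˢ I).biUnion fun v => T.filter fun w =>
      w.1 = v.1 ∧ w.2.1 = v.2.1 ∧ v.2.2 ∈ w.2.2.1 := by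
    intro w hw
    have hw' := hw
    simp only [hT, Finset.mem_filter, Finset.mem_product] at hw'
    obtain ⟨c, hc⟩ := hne _ hw'.1.2.2.1
    refine Finset.mem_biUnion.2 ⟨(w.1, w.2.1, c), ?_, Finset.mem_filter.2 ⟨hw, rfl, rfl, hc⟩⟩
    simp only [Finset.mem_product]
    exact ⟨hw'.1.1, hw'.1.2.1, (Finset.mem_powersetCard.1 hw'.1.2.2.1).1 hc⟩
  refine (Finset.card_le_card hsub).trans ((Finset.card_biUnion_le_card_mul _ _
    (k ^ 2 * (2 ^ k ^ 2 * 2 ^ k ^ 2)) ?_).trans ?_)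
  · rintro ⟨A, B, c⟩ hv
    simp only [Finset.mem_product] at hv
    have hS := card_add_le_sq (Finset.mem_powersetCard.1 hv.1).2
      (Finset.mem_powersetCard.1 hv.2.1).2
    refine le_trans (le_of_eq (Finset.card_image_of_injOn (f := fun w => w.2.2) ?_).symm)
      (card_add_eq_le hS c _ ?_)
    · intro w hw w' hw' h
      have h1 := (Finset.mem_filter.1 (Finset.mem_coe.1 hw)).2
      have h2 := (Finset.mem_filter.1 (Finset.mem_coe.1 hw')).2
      exact Prod.ext (h1.1.trans h2.1.symm) (Prod.ext (h1.2.1.trans h2.2.1.symm) h)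
    · intro v hv
      obtain ⟨w, hw, rfl⟩ := Finset.mem_image.1 hv
      obtain ⟨hw, h1, h2, h3⟩ := Finset.mem_filter.1 hw
      simp only [hT, Finset.mem_filter, Finset.mem_product] at hw h1 h2
      refine ⟨?_, h3, hne _ hw.1.2.2.2⟩
      rw [← hw.2, h1, h2]
  · rw [mul_comm]
    refine Nat.mul_le_mul_left _ ?_
    rw [Finset.card_product, Finset.card_product, two_mul, pow_succ, pow_add, mul_assoc]
    gcongr

/-- The triples with `A + A = C + D`. -/
lemma card_add_self_eq_add_le (hk : k ≠ 0) (I : Finset ℤ) :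
    ((Finset.powersetCard k I ×ˢ Finset.powersetCard k I ×ˢ
      Finset.powersetCard k I).filter fun w => w.1 + w.1 = w.2.1 + w.2.2).card ≤
      k ^ 2 * (2 ^ k ^ 2 * 2 ^ k ^ 2) * I.card ^ (k + 1) := by
  classical
  set K := Finset.powersetCard k I with hK
  have hKc : K.card ≤ I.card ^ k := card_powersetCard_le_pow I k
  have hne : ∀ C ∈ K, C.Nonempty := fun C hC =>
    Finset.card_pos.1 (by have := (Finset.mem_powersetCard.1 hC).2; omega)
  set T := (K ×ˢ K ×ˢ K).filter fun w => w.1 + w.1 = w.2.1 + w.2.2 with hT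
  have hsub : T ⊆ (K ×ˢ I).biUnion fun v => T.filter fun w => w.1 = v.1 ∧ v.2 ∈ w.2.1 := by
    intro w hw
    have hw' := hw
    simp only [hT, Finset.mem_filter, Finset.mem_product] at hw'
    obtain ⟨c, hc⟩ := hne _ hw'.1.2.1
    refine Finset.mem_biUnion.2 ⟨(w.1, c), ?_, Finset.mem_filter.2 ⟨hw, rfl, hc⟩⟩
    simp only [Finset.mem_product]
    exact ⟨hw'.1.1, (Finset.mem_powersetCard.1 hw'.1.2.1).1 hc⟩
  refine (Finset.card_le_card hsub).trans ((Finset.card_biUnion_le_card_mul _ _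
    (k ^ 2 * (2 ^ k ^ 2 * 2 ^ k ^ 2)) ?_).trans ?_)
  · rintro ⟨A, c⟩ hv
    simp only [Finset.mem_product] at hv
    have hA := (Finset.mem_powersetCard.1 hv.1).2
    refine le_trans (le_of_eq (Finset.card_image_of_injOn (f := fun w => w.2) ?_).symm)
      (card_add_eq_le (card_add_le_sq hA hA) c _ ?_)
    · intro w hw w' hw' h
      have h1 := (Finset.mem_filter.1 (Finset.mem_coe.1 hw)).2
      have h2 := (Finset.mem_filter.1 (Finset.mem_coe.1 hw')).2
      exact Prod.ext (h1.1.trans h2.1.symm) h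
    · intro v hv
      obtain ⟨w, hw, rfl⟩ := Finset.mem_image.1 hv
      obtain ⟨hw, h1, h3⟩ := Finset.mem_filter.1 hw
      simp only [hT, Finset.mem_filter, Finset.mem_product] at hw h1
      refine ⟨?_, h3, hne _ hw.1.2.2⟩
      rw [← hw.2, h1]
  · rw [mul_comm]
    refine Nat.mul_le_mul_left _ ?_
    rw [Finset.card_product, pow_succ]
    gcongr

/-- The pairs with `A + A = C + C` or `A + A = A + C`. -/
lemma card_add_self_eq_le (hk : k ≠ 0) (I : Finset ℤ) :
    ((Finset.powersetCard k I ×ˢ Finset.powersetCard k I).filter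
      fun w => w.1 + w.1 = w.2 + w.2 ∨ w.1 + w.1 = w.1 + w.2).card ≤
      (2 ^ k ^ 2 + 2 ^ k ^ 2) * I.card ^ k := by
  classical
  set K := Finset.powersetCard k I with hK
  refine le_trans (Finset.card_le_mul_card_image_of_maps_to (t := K) (f := fun w => w.1)
    (fun w hw => ?_) (2 ^ k ^ 2 + 2 ^ k ^ 2) fun A hA => ?_)
    (Nat.mul_le_mul_left _ (card_powersetCard_le_pow I k))
  · simp only [Finset.mem_filter, Finset.mem_product] at hw
    exact hw.1.1
  · have hA' := (Finset.mem_powersetCard.1 hA).2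
    obtain ⟨a, ha⟩ : A.Nonempty := Finset.card_pos.1 (by omega)
    have hS := card_add_le_sq hA' hA'
    -- If A + A = C + C, each c is half of the element c + c; if A + A = A + C, then C ⊆ A + A - a.
    refine le_trans (Finset.card_le_card_of_injOn (fun w => w.2)
      (t := ((A + A).image (· / 2)).powerset ∪ ((A + A).image (· - a)).powerset) ?_ ?_)
      ((Finset.card_union_le _ _).trans (Nat.add_le_add (card_powerset_image_le hS _)
        (card_powerset_image_le hS _)))
    · intro w hw
      obtain ⟨hw1, rfl⟩ := Finset.mem_filter.1 (Finset.mem_coe.1 hw)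
      simp only [Finset.coe_union, Set.mem_union, Finset.mem_coe, Finset.mem_powerset]
      rcases (Finset.mem_filter.1 hw1).2 with h | h
      · refine Or.inl fun c hc => Finset.mem_image.2 ⟨c + c, ?_, by omega⟩
        rw [h]
        exact Finset.add_mem_add hc hc
      · exact Or.inr (subset_image_sub_of_mem (by rw [add_comm]; exact h.symm) ha)
    · intro w hw w' hw' h
      exact Prod.ext ((Finset.mem_filter.1 (Finset.mem_coe.1 hw)).2.trans
        (Finset.mem_filter.1 (Finset.mem_coe.1 hw')).2.symm) h

end Counting

/-! ### Below the threshold: union bound -/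

section FirstMoment

open MeasureTheory ProbabilityTheory Filter

variable {k : ℕ}

lemma exists_of_notMem_sidonEvent {s : Set (Finset ℤ)} (h : s ∉ sidonEvent) :
    ∃ A ∈ s, ∃ B ∈ s, ∃ C ∈ s, ∃ D ∈ s, A + B = C + D ∧ ¬(A = C ∧ B = D) ∧ ¬(A = D ∧ B = C) := by
  simp only [sidonEvent, IsSidonSystem, Set.mem_ofPred_eq, not_forall] at h
  obtain ⟨⟨A, hA⟩, ⟨B, hB⟩, ⟨C, hC⟩, ⟨D, hD⟩, hsum, hne⟩ := h
  refine ⟨A, hA, B, hB, C, hC, D, hD, ?_, ?_, ?_⟩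
  · exact_mod_cast hsum
  · rintro ⟨rfl, rfl⟩
    exact hne rfl
  · rintro ⟨rfl, rfl⟩
    exact hne (Set.pair_comm _ _)

/-- Violations are sorted by their number of distinct sets, which is the exponent of p in the
probability of containing them. -/
lemma exists_superset_of_notMem_sidonEvent {K : Finset (Finset ℤ)} {s : Set (Finset ℤ)}
    (hs : s ⊆ K) (h : s ∉ sidonEvent) :
    (∃ w ∈ ((K ×ˢ K ×ˢ K ×ˢ K).filter fun w => w.1 + w.2.1 = w.2.2.1 + w.2.2.2).filter
      fun w => ({w.1, w.2.1, w.2.2.1, w.2.2.2} : Finset (Finset ℤ)).card = 4,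
      (({w.1, w.2.1, w.2.2.1, w.2.2.2} : Finset (Finset ℤ)) : Set (Finset ℤ)) ⊆ s) ∨
    (∃ w ∈ ((K ×ˢ K ×ˢ K).filter fun w => w.1 + w.2.1 = w.1 + w.2.2 ∧ w.2.1 ≠ w.2.2).filter
      fun w => ({w.1, w.2.1, w.2.2} : Finset (Finset ℤ)).card = 3,
      (({w.1, w.2.1, w.2.2} : Finset (Finset ℤ)) : Set (Finset ℤ)) ⊆ s) ∨
    (∃ w ∈ ((K ×ˢ K ×ˢ K).filter fun w => w.1 + w.1 = w.2.1 + w.2.2).filter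
      fun w => ({w.1, w.2.1, w.2.2} : Finset (Finset ℤ)).card = 3,
      (({w.1, w.2.1, w.2.2} : Finset (Finset ℤ)) : Set (Finset ℤ)) ⊆ s) ∨
    (∃ w ∈ ((K ×ˢ K).filter
      fun w => w.1 + w.1 = w.2 + w.2 ∨ w.1 + w.1 = w.1 + w.2).filter
      fun w => ({w.1, w.2} : Finset (Finset ℤ)).card = 2,
      (({w.1, w.2} : Finset (Finset ℤ)) : Set (Finset ℤ)) ⊆ s) := by
  obtain ⟨A, hA, B, hB, C, hC, D, hD, hsum, h1, h2⟩ := exists_of_notMem_sidonEvent h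
  have two : ∀ X ∈ s, ∀ Y ∈ s, X ≠ Y → (X + X = Y + Y ∨ X + X = X + Y) →
      (∃ w ∈ ((K ×ˢ K).filter
      fun w => w.1 + w.1 = w.2 + w.2 ∨ w.1 + w.1 = w.1 + w.2).filter
      fun w => ({w.1, w.2} : Finset (Finset ℤ)).card = 2,
      (({w.1, w.2} : Finset (Finset ℤ)) : Set (Finset ℤ)) ⊆ s) := by
    intro X hX Y hY hXY h
    refine ⟨(X, Y), ?_, ?_⟩
    · simp only [Finset.mem_filter, Finset.mem_product]
      exact ⟨⟨⟨hs hX, hs hY⟩, h⟩, Finset.card_pair hXY⟩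
    · simp [Set.insert_subset_iff, hX, hY]
  have threeA : ∀ X ∈ s, ∀ Y ∈ s, ∀ Z ∈ s, X ≠ Y → X ≠ Z → Y ≠ Z → X + Y = X + Z →
      (∃ w ∈ ((K ×ˢ K ×ˢ K).filter fun w => w.1 + w.2.1 = w.1 + w.2.2 ∧ w.2.1 ≠ w.2.2).filter
      fun w => ({w.1, w.2.1, w.2.2} : Finset (Finset ℤ)).card = 3,
      (({w.1, w.2.1, w.2.2} : Finset (Finset ℤ)) : Set (Finset ℤ)) ⊆ s) := by
    intro X hX Y hY Z hZ hXY hXZ hYZ h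
    refine ⟨(X, Y, Z), ?_, ?_⟩
    · simp only [Finset.mem_filter, Finset.mem_product]
      exact ⟨⟨⟨hs hX, hs hY, hs hZ⟩, h, hYZ⟩, Finset.card_eq_three.2 ⟨X, Y, Z, hXY, hXZ, hYZ, rfl⟩⟩
    · simp [Set.insert_subset_iff, hX, hY, hZ]
  have threeB : ∀ X ∈ s, ∀ Y ∈ s, ∀ Z ∈ s, X ≠ Y → X ≠ Z → Y ≠ Z → X + X = Y + Z →
      (∃ w ∈ ((K ×ˢ K ×ˢ K).filter fun w => w.1 + w.1 = w.2.1 + w.2.2).filter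
      fun w => ({w.1, w.2.1, w.2.2} : Finset (Finset ℤ)).card = 3,
      (({w.1, w.2.1, w.2.2} : Finset (Finset ℤ)) : Set (Finset ℤ)) ⊆ s) := by
    intro X hX Y hY Z hZ hXY hXZ hYZ h
    refine ⟨(X, Y, Z), ?_, ?_⟩
    · simp only [Finset.mem_filter, Finset.mem_product]
      exact ⟨⟨⟨hs hX, hs hY, hs hZ⟩, h⟩, Finset.card_eq_three.2 ⟨X, Y, Z, hXY, hXZ, hYZ, rfl⟩⟩
    · simp [Set.insert_subset_iff, hX, hY, hZ]
  by_cases hAB : A = B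
  · subst hAB
    by_cases hCD : C = D
    · subst hCD
      exact Or.inr <| Or.inr <| Or.inr <| two A hA C hC (by tauto) (Or.inl hsum)
    by_cases hAC : A = C
    · subst hAC
      exact Or.inr <| Or.inr <| Or.inr <| two A hA D hD hCD (Or.inr hsum)
    by_cases hAD : A = D
    · subst hAD
      exact Or.inr <| Or.inr <| Or.inr <| two A hA C hC hAC (Or.inr (by rw [hsum, add_comm]))
    exact Or.inr <| Or.inr <| Or.inl <| threeB A hA C hC D hD hAC hAD hCD hsum
  by_cases hCD : C = D
  · subst hCD
    by_cases hAC : A = C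
    · subst hAC
      exact Or.inr <| Or.inr <| Or.inr <| two A hA B hB hAB (Or.inr hsum.symm)
    by_cases hBC : B = C
    · subst hBC
      exact Or.inr <| Or.inr <| Or.inr <| two B hB A hA (Ne.symm hAB)
        (Or.inr (by rw [← hsum, add_comm]))
    exact Or.inr <| Or.inr <| Or.inl <| threeB C hC A hA B hB (Ne.symm hAC) (Ne.symm hBC) hAB
      hsum.symm
  by_cases hAC : A = C
  · subst hAC
    exact Or.inr <| Or.inl <| threeA A hA B hB D hD hAB hCD (by tauto) hsum
  by_cases hAD : A = D
  · subst hAD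
    exact Or.inr <| Or.inl <| threeA A hA B hB C hC hAB hAC (by tauto) (by rw [hsum, add_comm])
  by_cases hBC : B = C
  · subst hBC
    exact Or.inr <| Or.inl <| threeA B hB A hA D hD (Ne.symm hAB) hCD hAD
      (by rw [← hsum, add_comm])
  by_cases hBD : B = D
  · subst hBD
    exact Or.inr <| Or.inl <| threeA B hB A hA C hC (Ne.symm hAB) hBC hAC
      (by rw [add_comm, hsum, add_comm])
  refine Or.inl ⟨(A, B, C, D), ?_, ?_⟩
  · simp only [Finset.mem_filter, Finset.mem_product]
    refine ⟨⟨⟨hs hA, hs hB, hs hC, hs hD⟩, hsum⟩, ?_⟩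
    rw [Finset.card_insert_of_notMem (by simp [hAB, hAC, hAD]),
      Finset.card_insert_of_notMem (by simp [hBC, hBD]), Finset.card_pair hCD]
  · simp [Set.insert_subset_iff, hA, hB, hC, hD]

lemma natCast_pow_mul_pow_le {N d j : ℕ} (hN : 1 ≤ N) {p : ℝ} (hp : 0 ≤ p)
    (hd : 4 * d ≤ j * (2 * k + 1)) :
    (N : ℝ) ^ d * p ^ j ≤ (p * (N : ℝ) ^ ((2 * (k : ℝ) + 1) / 4)) ^ j := by
  have hN' : (1 : ℝ) ≤ N := by exact_mod_cast hN
  rw [mul_pow, mul_comm, ← Real.rpow_natCast (_ ^ _), ← Real.rpow_mul (by positivity),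
    ← Real.rpow_natCast (N : ℝ)]
  refine mul_le_mul_of_nonneg_left (Real.rpow_le_rpow_of_exponent_le hN' ?_) (by positivity)
  have : (4 * d : ℝ) ≤ j * (2 * k + 1) := by exact_mod_cast hd
  linarith

/-- Stated additively, this needs only subadditivity, not measurability of the Sidon event. -/
lemma one_le_randomSystem_real_sidonEvent_add (hk : 2 ≤ k) {N : ℕ} (hN : 1 ≤ N)
    (p : unitInterval) {r : ℝ} (hr : r = p * (N : ℝ) ^ ((2 * (k : ℝ) + 1) / 4)) :
    1 ≤ (randomSystem N k p).real sidonEvent +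
      (((k ^ 2 * (2 ^ k ^ 2 * 2 ^ k ^ 2) : ℕ) : ℝ) * r ^ 4 +
        (((2 ^ k ^ 2 * (k ^ k) ^ 2 : ℕ) : ℝ) * r ^ 3 +
        (((k ^ 2 * (2 ^ k ^ 2 * 2 ^ k ^ 2) : ℕ) : ℝ) * r ^ 3 +
        ((2 ^ k ^ 2 + 2 ^ k ^ 2 : ℕ) : ℝ) * r ^ 2))) := by
  have hk0 : k ≠ 0 := by omega
  set I := Finset.Icc (1 : ℤ) N with hI
  have hIc : I.card = N := by simp [hI]
  have hIn : I.Nonempty := Finset.card_pos.1 (by omega)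
  set K := Finset.powersetCard k I with hK
  set P := randomSystem N k p with hP
  have hprob : IsProbabilityMeasure P := by rw [hP, randomSystem]; infer_instance
  have hp0 : (0 : ℝ) ≤ p := p.2.1
  have hsub : ∀ᵐ s ∂P, s ⊆ (K : Set (Finset ℤ)) := setBernoulli_ae_subset
  have bound : ∀ {ι : Type} (T : Finset ι) (q : ι → Finset (Finset ℤ)) (j c d : ℕ),
      (∀ w ∈ T, (q w).card = j ∧ q w ⊆ K) → T.card ≤ c * I.card ^ d → 4 * d ≤ j * (2 * k + 1) →
      P.real {s | ∃ w ∈ T, (q w : Set (Finset ℤ)) ⊆ s} ≤ (c : ℝ) * r ^ j := by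
    intro ι T q j c d hq hc hd
    calc _ ≤ (T.card : ℝ) * (p : ℝ) ^ j := setBernoulli_real_exists_superset_le _ _ _ _
            (fun w hw => Finset.coe_subset.2 (hq w hw).2) _ fun w hw => (hq w hw).1
      _ ≤ (c * (N : ℝ) ^ d) * (p : ℝ) ^ j := by
            rw [hIc] at hc
            gcongr
            exact_mod_cast hc
      _ ≤ _ := by
            rw [mul_assoc, hr]
            exact mul_le_mul_of_nonneg_left (natCast_pow_mul_pow_le hN hp0 hd) (by positivity)
  -- The only class where the exponent condition is an equality: it sets the threshold.
  have b4 := bound (((K ×ˢ K ×ˢ K ×ˢ K).filter fun w => w.1 + w.2.1 = w.2.2.1 + w.2.2.2).filter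
      fun w => ({w.1, w.2.1, w.2.2.1, w.2.2.2} : Finset (Finset ℤ)).card = 4)
      (fun w => {w.1, w.2.1, w.2.2.1, w.2.2.2}) 4 _ (2 * k + 1) (by
        intro w hw
        simp only [Finset.mem_filter, Finset.mem_product] at hw
        refine ⟨hw.2, ?_⟩
        simp [Finset.insert_subset_iff, hw.1.1])
      ((Finset.card_filter_le _ _).trans (card_add_eq_add_le hk0 I)) le_rfl
  -- Here 4(k + k/2) ≤ 3(2k + 1), whereas the naive exponent 2k would fail for k ≥ 2.
  have b3 := bound (((K ×ˢ K ×ˢ K).filter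
      fun w => w.1 + w.2.1 = w.1 + w.2.2 ∧ w.2.1 ≠ w.2.2).filter
      fun w => ({w.1, w.2.1, w.2.2} : Finset (Finset ℤ)).card = 3)
      (fun w => {w.1, w.2.1, w.2.2}) 3 (2 ^ k ^ 2 * (k ^ k) ^ 2) (k + k / 2) (by
        intro w hw
        simp only [Finset.mem_filter, Finset.mem_product] at hw
        refine ⟨hw.2, ?_⟩
        simp [Finset.insert_subset_iff, hw.1.1])
      ((Finset.card_filter_le _ _).trans
        ((card_add_left_eq_le hk0 I hIn).trans_eq (by rw [mul_assoc]))) (by omega)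
  have b3' := bound (((K ×ˢ K ×ˢ K).filter fun w => w.1 + w.1 = w.2.1 + w.2.2).filter
      fun w => ({w.1, w.2.1, w.2.2} : Finset (Finset ℤ)).card = 3)
      (fun w => {w.1, w.2.1, w.2.2}) 3 _ (k + 1) (by
        intro w hw
        simp only [Finset.mem_filter, Finset.mem_product] at hw
        refine ⟨hw.2, ?_⟩
        simp [Finset.insert_subset_iff, hw.1.1])
      ((Finset.card_filter_le _ _).trans (card_add_self_eq_add_le hk0 I)) (by omega)
  have b2 := bound (((K ×ˢ K).filter
      fun w => w.1 + w.1 = w.2 + w.2 ∨ w.1 + w.1 = w.1 + w.2).filter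
      fun w => ({w.1, w.2} : Finset (Finset ℤ)).card = 2)
      (fun w => {w.1, w.2}) 2 _ k (by
        intro w hw
        simp only [Finset.mem_filter, Finset.mem_product] at hw
        refine ⟨hw.2, ?_⟩
        simp [Finset.insert_subset_iff, hw.1.1])
      ((Finset.card_filter_le _ _).trans (card_add_self_eq_le hk0 I)) (by omega)
  calc (1 : ℝ) = P.real Set.univ := by simp
    _ ≤ P.real (sidonEvent ∪ (_ ∪ (_ ∪ (_ ∪ _)))) := by
        refine ENNReal.toReal_mono (measure_ne_top _ _) (measure_mono_ae ?_)
        filter_upwards [hsub] with s hs _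
        by_cases h : s ∈ sidonEvent
        · exact Or.inl h
        · exact Or.inr (exists_superset_of_notMem_sidonEvent hs h)
    _ ≤ _ := by
        refine (measureReal_union_le _ _).trans (add_le_add le_rfl ?_)
        refine (measureReal_union_le _ _).trans (add_le_add b4 ?_)
        refine (measureReal_union_le _ _).trans (add_le_add b3 ?_)
        exact (measureReal_union_le _ _).trans (add_le_add b3' b2)

lemma tendsto_randomSystem_real_sidonEvent_one (hk : 2 ≤ k) (p : ℕ → unitInterval)
    (hp : (fun N : ℕ => (p N : ℝ)) =o[atTop]
      (fun N : ℕ => (N : ℝ) ^ (-((2 * (k : ℝ) + 1) / 4)))) :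
    Tendsto (fun N : ℕ => (randomSystem N k (p N)).real sidonEvent) atTop (nhds 1) := by
  have hr : Tendsto (fun N : ℕ => (p N : ℝ) * (N : ℝ) ^ ((2 * (k : ℝ) + 1) / 4)) atTop (nhds 0) := by
    refine hp.tendsto_div_nhds_zero.congr fun N => ?_
    rw [Real.rpow_neg (Nat.cast_nonneg N), div_inv_eq_mul]
  have hlow := tendsto_const_nhds (x := (1 : ℝ)) |>.sub
    (((hr.pow 4).const_mul ((k ^ 2 * (2 ^ k ^ 2 * 2 ^ k ^ 2) : ℕ) : ℝ)).add
      (((hr.pow 3).const_mul ((2 ^ k ^ 2 * (k ^ k) ^ 2 : ℕ) : ℝ)).add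
      (((hr.pow 3).const_mul ((k ^ 2 * (2 ^ k ^ 2 * 2 ^ k ^ 2) : ℕ) : ℝ)).add
      ((hr.pow 2).const_mul ((2 ^ k ^ 2 + 2 ^ k ^ 2 : ℕ) : ℝ)))))
  have hprob : ∀ N, IsProbabilityMeasure (randomSystem N k (p N)) := fun N => by
    rw [randomSystem]; infer_instance
  refine tendsto_of_tendsto_of_tendsto_of_le_of_le' (by simpa using hlow) tendsto_const_nhds ?_
    (Eventually.of_forall fun N => measureReal_le_one)
  filter_upwards [eventually_ge_atTop 1] with N hN
  rw [sub_le_iff_le_add]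
  exact_mod_cast one_le_randomSystem_real_sidonEvent_add hk hN (p N) rfl

end FirstMoment

/-! ### Above the threshold: quadruples of translates -/

section SecondMoment

open MeasureTheory ProbabilityTheory Filter

/-- A set of integers together with its translate by `t`. -/
def translatePair (t : ℤ) (A : Finset ℤ) : Finset (Finset ℤ) := {A, t +ᵥ A}

lemma translatePair_vadd (t c : ℤ) (A : Finset ℤ) :
    translatePair t (c +ᵥ A) = (translatePair t A).image (c +ᵥ ·) := by
  simp only [translatePair, Finset.image_insert, Finset.image_singleton]
  rw [vadd_comm]

/-- Translation by t adds |A| t to the sum of the elements. -/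
lemma eq_of_vadd_finset_eq {t t' : ℤ} {A : Finset ℤ} (hA : A.Nonempty) (h : t +ᵥ A = t' +ᵥ A) :
    t = t' := by
  have h1 : ∀ c : ℤ, ∑ x ∈ c +ᵥ A, x = A.card * c + ∑ x ∈ A, x := by
    intro c
    rw [← Finset.image_vadd, Finset.sum_image (fun x _ y _ hxy => by simpa using hxy)]
    change ∑ x ∈ A, (c + x) = _
    rw [Finset.sum_add_distrib, Finset.sum_const, nsmul_eq_mul]
  have h2 := h1 t
  rw [h, h1 t'] at h2
  have h3 : (A.card : ℤ) ≠ 0 := by exact_mod_cast hA.card_pos.ne'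
  exact (mul_left_cancel₀ h3 (by linarith)).symm

lemma vadd_subset_Icc {A : Finset ℤ} {a b : ℤ} (hA : A ⊆ Finset.Icc a b) {t a' b' : ℤ}
    (ha : a' ≤ t + a) (hb : t + b ≤ b') : t +ᵥ A ⊆ Finset.Icc a' b' := by
  intro x hx
  obtain ⟨y, hy, rfl⟩ := Finset.mem_vadd_finset.1 hx
  have := Finset.mem_Icc.1 (hA hy)
  simp only [vadd_eq_add, Finset.mem_Icc]
  omega

lemma ne_of_subset_Icc {A B : Finset ℤ} (hA : A.Nonempty) {a b c d : ℤ}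
    (hAI : A ⊆ Finset.Icc a b) (hBI : B ⊆ Finset.Icc c d) (hbc : b < c) : A ≠ B := by
  rintro rfl
  obtain ⟨x, hx⟩ := hA
  have := Finset.mem_Icc.1 (hAI hx)
  have := Finset.mem_Icc.1 (hBI hx)
  omega

variable {k n : ℕ}

lemma mem_powersetCard_Icc (hk : k ≠ 0) {A : Finset ℤ}
    (hA : A ∈ Finset.powersetCard k (Finset.Icc (1 : ℤ) n)) :
    A ⊆ Finset.Icc 1 (n : ℤ) ∧ A.Nonempty :=
  ⟨(Finset.mem_powersetCard.1 hA).1,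
    Finset.card_pos.1 (by have := (Finset.mem_powersetCard.1 hA).2; omega)⟩

lemma subset_Icc_of_mem_translatePair {A X : Finset ℤ} {t a b c : ℤ} (hA : A ⊆ Finset.Icc a b)
    (hAne : A.Nonempty) (ht : 0 ≤ t) (hc : t + b ≤ c) (hX : X ∈ translatePair t A) :
    X ⊆ Finset.Icc a c ∧ X.Nonempty := by
  simp only [translatePair, Finset.mem_insert, Finset.mem_singleton] at hX
  rcases hX with rfl | rfl
  · exact ⟨hA.trans (Finset.Icc_subset_Icc le_rfl (by omega)), hAne⟩
  · exact ⟨vadd_subset_Icc hA (by omega) hc, hAne.vadd_finset⟩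

/-- Two pairs of translates by the same `t`, one in `[1, 3n]` and the other in `[3n + 1, 6n]`. -/
def translateQuad (n : ℕ) (w : ℤ × Finset ℤ × Finset ℤ) : Finset (Finset ℤ) :=
  translatePair w.1 w.2.1 ∪ translatePair w.1 ((3 * n : ℤ) +ᵥ w.2.2)

/-- The index set of the quadruples of translates. -/
noncomputable def translateQuadIndex (k n : ℕ) : Finset (ℤ × Finset ℤ × Finset ℤ) :=
  Finset.Ico (n : ℤ) (2 * n) ×ˢ Finset.powersetCard k (Finset.Icc (1 : ℤ) n) ×ˢ
    Finset.powersetCard k (Finset.Icc (1 : ℤ) n)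

lemma disjoint_translatePair {A B : Finset ℤ} {t t' : ℤ} (hA : A ⊆ Finset.Icc 1 (n : ℤ))
    (hAne : A.Nonempty) (hB : B ⊆ Finset.Icc 1 (n : ℤ)) (hBne : B.Nonempty)
    (ht : t ∈ Finset.Ico (n : ℤ) (2 * n)) (ht' : t' ∈ Finset.Ico (n : ℤ) (2 * n)) :
    Disjoint (translatePair t A) (translatePair t' ((3 * n : ℤ) +ᵥ B)) := by
  rw [Finset.mem_Ico] at ht ht'
  rw [Finset.disjoint_left]
  intro X hX hX'
  have h1 := subset_Icc_of_mem_translatePair (c := 3 * n) hA hAne (by omega) (by omega) hX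
  have h2 := subset_Icc_of_mem_translatePair (a := 3 * n + 1) (b := 4 * n) (c := 6 * n)
    (vadd_subset_Icc hB (by omega) (by omega)) hBne.vadd_finset (by omega) (by omega) hX'
  exact ne_of_subset_Icc h1.2 h1.1 h2.1 (by omega) rfl

/-- Since t, t' ≥ n, both translates lie above [1, n], so an original never equals a translate. -/
lemma card_translatePair_union {A A' : Finset ℤ} {t t' : ℤ} (hA : A ⊆ Finset.Icc 1 (n : ℤ))
    (hAne : A.Nonempty) (hA' : A' ⊆ Finset.Icc 1 (n : ℤ)) (hAne' : A'.Nonempty)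
    (ht : t ∈ Finset.Ico (n : ℤ) (2 * n)) (ht' : t' ∈ Finset.Ico (n : ℤ) (2 * n)) :
    (translatePair t A ∪ translatePair t' A').card =
      ({A, A'} : Finset (Finset ℤ)).card + ({t +ᵥ A, t' +ᵥ A'} : Finset (Finset ℤ)).card := by
  rw [Finset.mem_Ico] at ht ht'
  have h1 : ∀ s ∈ ({t, t'} : Set ℤ), ∀ B ∈ ({A, A'} : Set (Finset ℤ)),
      s +ᵥ B ⊆ Finset.Icc (n + 1 : ℤ) (3 * n) := by
    rintro s hs B hB
    have hB' : B ⊆ Finset.Icc 1 (n : ℤ) := by rcases hB with rfl | rfl <;> assumption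
    rcases hs with rfl | rfl <;> exact vadd_subset_Icc hB' (by omega) (by omega)
  rw [← Finset.card_union_of_disjoint]
  · congr 1
    ext X
    simp only [translatePair, Finset.mem_union, Finset.mem_insert, Finset.mem_singleton]
    tauto
  · rw [Finset.disjoint_left]
    intro X hX hX'
    simp only [Finset.mem_insert, Finset.mem_singleton] at hX hX'
    have hX1 : X ⊆ Finset.Icc 1 (n : ℤ) ∧ X.Nonempty := by
      rcases hX with rfl | rfl <;> exact ⟨by assumption, by assumption⟩
    have hX2 : X ⊆ Finset.Icc (n + 1 : ℤ) (3 * n) := by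
      rcases hX' with rfl | rfl <;> exact h1 _ (by simp) _ (by simp)
    exact ne_of_subset_Icc hX1.2 hX1.1 hX2 (by omega) rfl

/-- If t = t', the originals coincide exactly when the translates do; if t ≠ t', at most one of
these coincidences occurs. The indicator form makes the sum over A' immediate. -/
lemma pow_card_translatePair_union_le {p : ℝ} (hp : 0 ≤ p) {A A' : Finset ℤ} {t t' : ℤ}
    (hA : A ⊆ Finset.Icc 1 (n : ℤ)) (hAne : A.Nonempty) (hA' : A' ⊆ Finset.Icc 1 (n : ℤ))
    (hAne' : A'.Nonempty) (ht : t ∈ Finset.Ico (n : ℤ) (2 * n))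
    (ht' : t' ∈ Finset.Ico (n : ℤ) (2 * n)) :
    p ^ (translatePair t A ∪ translatePair t' A').card ≤ p ^ 4 +
      (if A = A' then (if t = t' then p ^ 2 else p ^ 3) else 0) +
      (if t +ᵥ A = t' +ᵥ A' then (if t = t' then 0 else p ^ 3) else 0) := by
  rw [card_translatePair_union hA hAne hA' hAne' ht ht']
  have h2 : 0 ≤ p ^ 2 := by positivity
  have h3 : 0 ≤ p ^ 3 := by positivity
  have h4 : 0 ≤ p ^ 4 := by positivity
  by_cases h : A = A'
  · subst h
    by_cases htt : t = t'
    · subst htt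
      simp [h4]
    · have hne : t +ᵥ A ≠ t' +ᵥ A := fun h => htt (eq_of_vadd_finset_eq hAne h)
      rw [Finset.card_pair hne]
      simp [hne, htt, h4]
  · rw [Finset.card_pair h]
    by_cases hv : t +ᵥ A = t' +ᵥ A'
    · have htt : t ≠ t' := by
        rintro rfl
        exact h (by simpa using hv)
      simp [h, hv, htt, h4]
    · rw [Finset.card_pair hv]
      simp [h, hv]

lemma sum_pow_card_translatePair_union_le (hk : k ≠ 0) {p : ℝ} (hp : 0 ≤ p) {t t' : ℤ}
    (ht : t ∈ Finset.Ico (n : ℤ) (2 * n)) (ht' : t' ∈ Finset.Ico (n : ℤ) (2 * n)) :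
    ∑ A ∈ Finset.powersetCard k (Finset.Icc (1 : ℤ) n),
      ∑ A' ∈ Finset.powersetCard k (Finset.Icc (1 : ℤ) n),
        p ^ (translatePair t A ∪ translatePair t' A').card ≤
      if t = t' then (n.choose k : ℝ) ^ 2 * p ^ 4 + n.choose k * p ^ 2
      else (n.choose k : ℝ) ^ 2 * p ^ 4 + 2 * (n.choose k * p ^ 3) := by
  set K := Finset.powersetCard k (Finset.Icc (1 : ℤ) n) with hK
  have hKc : K.card = n.choose k := by simp [hK]
  have h1 : ∀ A ∈ K, ∑ A' ∈ K, p ^ (translatePair t A ∪ translatePair t' A').card ≤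
      n.choose k * p ^ 4 + (if t = t' then p ^ 2 else p ^ 3) + (if t = t' then 0 else p ^ 3) := by
    intro A hA
    obtain ⟨hAI, hAne⟩ := mem_powersetCard_Icc hk hA
    refine (Finset.sum_le_sum fun A' hA' => pow_card_translatePair_union_le hp hAI hAne
      (mem_powersetCard_Icc hk hA').1 (mem_powersetCard_Icc hk hA').2 ht ht').trans ?_
    rw [Finset.sum_add_distrib, Finset.sum_add_distrib, Finset.sum_const, hKc, nsmul_eq_mul]
    refine add_le_add (add_le_add le_rfl ?_) ?_
    · rw [Finset.sum_ite_eq, if_pos hA]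
    -- Given A, t and t', only one A' is possible, and it may fall outside K.
    · have : ∀ A', (t +ᵥ A = t' +ᵥ A') ↔ (-t' +ᵥ (t +ᵥ A) = A') := fun A' => by
        rw [neg_vadd_eq_iff]
      simp only [this]
      rw [Finset.sum_ite_eq]
      have : 0 ≤ (if t = t' then 0 else p ^ 3) := by split_ifs <;> positivity
      split_ifs at this ⊢ <;> simp_all
  refine (Finset.sum_le_sum h1).trans (le_of_eq ?_)
  rw [Finset.sum_const, hKc, nsmul_eq_mul]
  split_ifs <;> ring

/-- For fixed t and t', the sums over the two halves are independent and equal, whence the square.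
-/
lemma sum_sum_translateQuadIndex (x : ℤ → ℤ → Finset ℤ → Finset ℤ → ℝ) :
    ∑ w ∈ translateQuadIndex k n, ∑ w' ∈ translateQuadIndex k n,
      x w.1 w'.1 w.2.1 w'.2.1 * x w.1 w'.1 w.2.2 w'.2.2 =
    ∑ t ∈ Finset.Ico (n : ℤ) (2 * n), ∑ t' ∈ Finset.Ico (n : ℤ) (2 * n),
      (∑ A ∈ Finset.powersetCard k (Finset.Icc (1 : ℤ) n),
        ∑ A' ∈ Finset.powersetCard k (Finset.Icc (1 : ℤ) n), x t t' A A') ^ 2 := by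
  simp only [translateQuadIndex, Finset.sum_product, sq, Finset.sum_mul_sum]
  refine Finset.sum_congr rfl fun t _ => ?_
  rw [Finset.sum_comm (s := Finset.Ico (n : ℤ) (2 * n))]
  exact Finset.sum_congr rfl fun A _ => Finset.sum_comm

/-- In A + (t + B') = (t + A) + B' with B' = 3n + B, both right-hand summands lie above [1, n], so
neither is A. -/
lemma sidonEvent_subset (hk : k ≠ 0) :
    sidonEvent ⊆ {s | ∀ w ∈ translateQuadIndex k n, ¬ (translateQuad n w : Set (Finset ℤ)) ⊆ s} := by
  rintro s hs ⟨t, A, B⟩ hw hsub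
  simp only [translateQuadIndex, Finset.mem_product] at hw
  obtain ⟨ht, hA, hB⟩ := hw
  rw [Finset.mem_Ico] at ht
  obtain ⟨hA, hAne⟩ := mem_powersetCard_Icc hk hA
  obtain ⟨hB, hBne⟩ := mem_powersetCard_Icc hk hB
  have mem : ∀ X, X ∈ translateQuad n (t, A, B) → X ∈ s := fun X hX => hsub hX
  have h1 : A ∈ s := mem _ (by simp [translateQuad, translatePair])
  have h2 : t +ᵥ A ∈ s := mem _ (by simp [translateQuad, translatePair])
  have h3 : (3 * n : ℤ) +ᵥ B ∈ s := mem _ (by simp [translateQuad, translatePair])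
  have h4 : t +ᵥ ((3 * n : ℤ) +ᵥ B) ∈ s := mem _ (by simp [translateQuad, translatePair])
  have hsum : A + (t +ᵥ ((3 * n : ℤ) +ᵥ B)) = (t +ᵥ A) + ((3 * n : ℤ) +ᵥ B) := by
    rw [vadd_add_assoc, add_vadd_comm]
  have := hs ⟨A, h1⟩ ⟨_, h4⟩ ⟨_, h2⟩ ⟨_, h3⟩ (by dsimp only; exact_mod_cast hsum)
  have hmem : (⟨A, h1⟩ : s) ∈ ({⟨_, h2⟩, ⟨_, h3⟩} : Set s) := this ▸ by simp
  simp only [Set.mem_insert_iff, Set.mem_singleton_iff, Subtype.mk.injEq] at hmem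
  rcases hmem with h | h
  · exact ne_of_subset_Icc hAne hA (c := n + 1) (d := 3 * n)
      (vadd_subset_Icc hA (by omega) (by omega)) (by omega) h
  · exact ne_of_subset_Icc hAne hA (c := 3 * n + 1) (d := 4 * n)
      (vadd_subset_Icc hB (by omega) (by omega)) (by omega) h

lemma translateQuad_subset_kSubsets {N : ℕ} (hN : 6 * n ≤ N)
    {w : ℤ × Finset ℤ × Finset ℤ} (hw : w ∈ translateQuadIndex k n) :
    (translateQuad n w : Set (Finset ℤ)) ⊆ kSubsets N k := by
  obtain ⟨t, A, B⟩ := w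
  simp only [translateQuadIndex, Finset.mem_product, Finset.mem_Ico, Finset.mem_powersetCard] at hw
  obtain ⟨ht, ⟨hA, hAc⟩, ⟨hB, hBc⟩⟩ := hw
  intro X hX
  have hN' : (6 * n : ℤ) ≤ N := by exact_mod_cast hN
  rw [kSubsets, Finset.mem_coe, Finset.mem_powersetCard]
  simp only [translateQuad, translatePair, Finset.coe_union, Finset.coe_insert,
    Finset.coe_singleton, Set.mem_union, Set.mem_insert_iff, Set.mem_singleton_iff] at hX
  rcases hX with (rfl | rfl) | (rfl | rfl)
  · exact ⟨hA.trans (Finset.Icc_subset_Icc le_rfl (by omega)), hAc⟩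
  · exact ⟨vadd_subset_Icc hA (by omega) (by omega), by simp [hAc]⟩
  · exact ⟨vadd_subset_Icc hB (by omega) (by omega), by simp [hBc]⟩
  · rw [vadd_vadd]
    exact ⟨vadd_subset_Icc hB (by omega) (by omega), by simp [hBc]⟩

/-- The halves lie in [1, 3n] and [3n + 1, 6n], so they never share a set, and the shift by 3n
preserves cardinality. -/
lemma card_translateQuad_union (hk : k ≠ 0) {w w' : ℤ × Finset ℤ × Finset ℤ}
    (hw : w ∈ translateQuadIndex k n) (hw' : w' ∈ translateQuadIndex k n) :
    (translateQuad n w ∪ translateQuad n w').card =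
      (translatePair w.1 w.2.1 ∪ translatePair w'.1 w'.2.1).card +
      (translatePair w.1 w.2.2 ∪ translatePair w'.1 w'.2.2).card := by
  obtain ⟨t, A, B⟩ := w
  obtain ⟨t', A', B'⟩ := w'
  simp only [translateQuadIndex, Finset.mem_product] at hw hw'
  obtain ⟨ht, hA, hB⟩ := hw
  obtain ⟨ht', hA', hB'⟩ := hw'
  obtain ⟨hA, hAne⟩ := mem_powersetCard_Icc hk hA
  obtain ⟨hB, hBne⟩ := mem_powersetCard_Icc hk hB
  obtain ⟨hA', hAne'⟩ := mem_powersetCard_Icc hk hA'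
  obtain ⟨hB', hBne'⟩ := mem_powersetCard_Icc hk hB'
  simp only [translateQuad]
  rw [Finset.union_union_union_comm, Finset.card_union_of_disjoint]
  · rw [translatePair_vadd, translatePair_vadd, ← Finset.image_union,
      Finset.card_image_of_injective _ (AddAction.injective _)]
  · simp only [Finset.disjoint_union_left, Finset.disjoint_union_right]
    exact ⟨⟨disjoint_translatePair hA hAne hB hBne ht ht,
      disjoint_translatePair hA' hAne' hB hBne ht' ht⟩,
      ⟨disjoint_translatePair hA hAne hB' hBne' ht ht',
      disjoint_translatePair hA' hAne' hB' hBne' ht' ht'⟩⟩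

lemma card_translateQuad (hk : k ≠ 0) {w : ℤ × Finset ℤ × Finset ℤ}
    (hw : w ∈ translateQuadIndex k n) : (translateQuad n w).card = 4 := by
  have h := card_translateQuad_union hk hw hw
  obtain ⟨t, A, B⟩ := w
  simp only [translateQuadIndex, Finset.mem_product] at hw
  obtain ⟨ht, hA, hB⟩ := hw
  obtain ⟨hA, hAne⟩ := mem_powersetCard_Icc hk hA
  obtain ⟨hB, hBne⟩ := mem_powersetCard_Icc hk hB
  rw [card_translatePair_union hA hAne hA hAne ht ht,
    card_translatePair_union hB hBne hB hBne ht ht] at h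
  simpa using h

lemma randomSystem_real_sidonEvent_le (hk : k ≠ 0) (hkn : k ≤ n) {N : ℕ} (hN : 6 * n ≤ N)
    (p : unitInterval) (hp : 0 < (p : ℝ)) :
    (randomSystem N k p).real sidonEvent ≤ 2 / n + 2 / (n * (n.choose k : ℝ) ^ 2 * p ^ 4) +
      4 / (n.choose k * p) + 4 / (n.choose k * p) ^ 2 := by
  have hn : n ≠ 0 := by omega
  set m : ℝ := (n.choose k : ℝ) with hm
  have hm0 : 0 < m := by
    rw [hm]; exact_mod_cast Nat.choose_pos hkn
  have hn0 : (0 : ℝ) < n := by exact_mod_cast Nat.pos_of_ne_zero hn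
  obtain ⟨p, hp01⟩ := p
  simp only at hp ⊢
  set μ : ℝ := n * (m ^ 2 * p ^ 4) with hμ
  set V : ℝ := n * (m ^ 2 * p ^ 4 + m * p ^ 2) ^ 2 + n * (n * (m ^ 2 * p ^ 4 + 2 * (m * p ^ 3)) ^ 2)
    with hV
  have hIco : ((Finset.Ico (n : ℤ) (2 * n)).card : ℝ) = n := by
    rw [Int.card_Ico, show (2 * (n : ℤ) - n).toNat = n by omega]
  have hcard : ((translateQuadIndex k n).card : ℝ) = n * m ^ 2 := by
    rw [translateQuadIndex, Finset.card_product, Finset.card_product, Finset.card_powersetCard,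
      Int.card_Icc, Nat.cast_mul, hIco, show ((n : ℤ) + 1 - 1).toNat = n by omega, hm]
    push_cast; ring
  have h1 : ∑ w ∈ translateQuadIndex k n, p ^ (translateQuad n w).card = μ := by
    rw [Finset.sum_congr rfl fun w hw => by rw [card_translateQuad hk hw], Finset.sum_const,
      nsmul_eq_mul, hcard, hμ]
    ring
  have h2 : ∑ w ∈ translateQuadIndex k n, ∑ w' ∈ translateQuadIndex k n,
      p ^ (translateQuad n w ∪ translateQuad n w').card ≤ V := by
    rw [Finset.sum_congr rfl fun w hw => Finset.sum_congr rfl fun w' hw' => by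
      rw [card_translateQuad_union hk hw hw', pow_add]]
    rw [sum_sum_translateQuadIndex fun t t' A A' => p ^ (translatePair t A ∪ translatePair t' A').card]
    have hinner : ∀ t ∈ Finset.Ico (n : ℤ) (2 * n), ∑ t' ∈ Finset.Ico (n : ℤ) (2 * n),
        (∑ A ∈ Finset.powersetCard k (Finset.Icc (1 : ℤ) n),
          ∑ A' ∈ Finset.powersetCard k (Finset.Icc (1 : ℤ) n),
            p ^ (translatePair t A ∪ translatePair t' A').card) ^ 2 ≤
        (m ^ 2 * p ^ 4 + m * p ^ 2) ^ 2 + n * (m ^ 2 * p ^ 4 + 2 * (m * p ^ 3)) ^ 2 := by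
      intro t ht
      calc _ ≤ ∑ t' ∈ Finset.Ico (n : ℤ) (2 * n), ((if t = t' then (m ^ 2 * p ^ 4 + m * p ^ 2) ^ 2
              else 0) + (m ^ 2 * p ^ 4 + 2 * (m * p ^ 3)) ^ 2) := by
            refine Finset.sum_le_sum fun t' ht' => ?_
            refine (pow_le_pow_left₀ (Finset.sum_nonneg fun _ _ => Finset.sum_nonneg
              fun _ _ => by positivity)
              (sum_pow_card_translatePair_union_le hk hp.le ht ht') 2).trans ?_
            rw [← hm]
            split_ifs
            · exact le_add_of_nonneg_right (by positivity)
            · simp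
        _ = _ := by
            rw [Finset.sum_add_distrib, Finset.sum_ite_eq, if_pos ht, Finset.sum_const,
              nsmul_eq_mul, hIco]
    refine (Finset.sum_le_sum hinner).trans (le_of_eq ?_)
    rw [Finset.sum_const, nsmul_eq_mul, hIco, hV]
    ring
  have h3 := setBernoulli_real_forall_not_superset_le (kSubsets N k) ⟨p, hp01⟩
    (translateQuadIndex k n) (translateQuad n)
    (fun w hw => translateQuad_subset_kSubsets hN hw) (μ := μ) (V := V) (by positivity) h1 h2
  refine (measureReal_mono (sidonEvent_subset hk) (measure_ne_top (setBernoulli _ _) _)).trans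
    (h3.trans ?_)
  -- V / μ^2 = (1 + x)^2 / n + (1 + 2/(mp))^2 with x = 1/(mp^2); the slack is that of (1 + x)^2 ≤ 2
  -- + 2x^2.
  have key : 2 / n + 2 / (n * m ^ 2 * p ^ 4) + 4 / (m * p) + 4 / (m * p) ^ 2 - (V / μ ^ 2 - 1) =
      (m * p ^ 2 - 1) ^ 2 / (n * m ^ 2 * p ^ 4) := by
    rw [hV, hμ]
    field_simp
    ring
  have : 0 ≤ (m * p ^ 2 - 1) ^ 2 / (n * m ^ 2 * p ^ 4) := by positivity
  linarith

lemma le_choose_div_six (hk : k ≠ 0) {N : ℕ} (hN : 12 * k ≤ N) :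
    k ≤ N / 6 ∧ (N : ℝ) / 12 ≤ (N / 6 : ℕ) ∧
      (N : ℝ) ^ k / (12 ^ k * k.factorial) ≤ (N / 6).choose k := by
  -- The + 1 outweighs the rounding, and k ≤ N/12 leaves at least N/12.
  have h1 : N ≤ 12 * (N / 6 + 1 - k) := by omega
  have h1' : (N : ℝ) / 12 ≤ (N / 6 + 1 - k : ℕ) := by
    rw [div_le_iff₀ (by norm_num), mul_comm]
    exact_mod_cast h1
  refine ⟨by omega, h1'.trans (by exact_mod_cast (by omega)), ?_⟩
  refine le_trans ?_ (Nat.pow_le_choose k (N / 6))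
  rw [← div_div, ← div_pow]
  gcongr

lemma tendsto_randomSystem_real_sidonEvent_zero (hk : k ≠ 0) (p : ℕ → unitInterval)
    (hp : (fun N : ℕ => (N : ℝ) ^ (-((2 * (k : ℝ) + 1) / 4))) =o[atTop]
      (fun N : ℕ => (p N : ℝ))) :
    Tendsto (fun N : ℕ => (randomSystem N k (p N)).real sidonEvent) atTop (nhds 0) := by
  set r : ℕ → ℝ := fun N => (p N : ℝ) * (N : ℝ) ^ ((2 * (k : ℝ) + 1) / 4) with hr
  have hp0 : ∀ᶠ N in atTop, 0 < (p N : ℝ) := by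
    filter_upwards [hp.bound one_pos, eventually_ge_atTop 1] with N h hN
    have hN' : (0 : ℝ) < N := by exact_mod_cast hN
    have h1 : 0 < (N : ℝ) ^ (-((2 * (k : ℝ) + 1) / 4)) := by positivity
    rw [Real.norm_of_nonneg h1.le, Real.norm_of_nonneg (p N).2.1] at h
    linarith
  have hr0 : Tendsto (fun N => (r N)⁻¹) atTop (nhds 0) := by
    refine hp.tendsto_div_nhds_zero.congr fun N => ?_
    rw [Real.rpow_neg (Nat.cast_nonneg N), hr, mul_inv, div_eq_mul_inv, mul_comm]
  set c : ℝ := (12 ^ k * k.factorial)⁻¹ with hc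
  have hc0 : 0 < c := by positivity
  have hlim : Tendsto (fun N : ℕ => 24 * (N : ℝ)⁻¹ + 24 / c ^ 2 * ((r N)⁻¹) ^ 4 +
      4 / c * (r N)⁻¹ + 4 / c ^ 2 * ((r N)⁻¹) ^ 2) atTop (nhds 0) := by
    have := (((tendsto_inv_atTop_nhds_zero_nat (𝕜 := ℝ)).const_mul 24).add
      ((hr0.pow 4).const_mul (24 / c ^ 2))).add (hr0.const_mul (4 / c)) |>.add
      ((hr0.pow 2).const_mul (4 / c ^ 2))
    simpa using this
  refine tendsto_of_tendsto_of_tendsto_of_le_of_le' tendsto_const_nhds hlim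
    (Eventually.of_forall fun N => measureReal_nonneg) ?_
  filter_upwards [hp0, eventually_ge_atTop (12 * k)] with N hpN hN
  have hN1 : 1 ≤ N := by omega
  have hN0 : (0 : ℝ) < N := by exact_mod_cast hN1
  have hN1' : (1 : ℝ) ≤ N := by exact_mod_cast hN1
  obtain ⟨hkn, hn, hm⟩ := le_choose_div_six hk hN
  have hrN : 0 < r N := by simp only [hr]; positivity
  refine (randomSystem_real_sidonEvent_le hk hkn (Nat.mul_div_le N 6) (p N) hpN).trans ?_
  have hrq : r N = (p N : ℝ) * (N : ℝ) ^ ((2 * (k : ℝ) + 1) / 4) := rfl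
  generalize ((N / 6).choose k : ℝ) = m at *
  generalize ((N / 6 : ℕ) : ℝ) = n at *
  generalize (p N : ℝ) = q at *
  have hm' : c * (N : ℝ) ^ k ≤ m := by
    rw [hc, inv_mul_eq_div]; exact hm
  -- Uses (2k + 1)/4 ≤ k, valid as k ≥ 1.
  have hu : c * r N ≤ m * q := by
    have h1 : (N : ℝ) ^ ((2 * (k : ℝ) + 1) / 4) ≤ (N : ℝ) ^ k := by
      rw [← Real.rpow_natCast]
      refine Real.rpow_le_rpow_of_exponent_le hN1' ?_
      have : (1 : ℝ) ≤ k := by exact_mod_cast Nat.one_le_iff_ne_zero.2 hk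
      linarith
    calc c * r N = q * (c * (N : ℝ) ^ ((2 * (k : ℝ) + 1) / 4)) := by rw [hrq]; ring
      _ ≤ q * (c * (N : ℝ) ^ k) := by gcongr
      _ ≤ q * m := by gcongr
      _ = m * q := mul_comm _ _
  -- The expected number of quadruples is at least a constant times N^(2k+1) q^4 = r^4.
  have hv : c ^ 2 / 12 * (r N) ^ 4 ≤ n * m ^ 2 * q ^ 4 := by
    have h4 : ((N : ℝ) ^ ((2 * (k : ℝ) + 1) / 4)) ^ 4 = (N : ℝ) ^ (2 * k + 1) := by
      rw [← Real.rpow_natCast, ← Real.rpow_mul hN0.le, ← Real.rpow_natCast]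
      congr 1
      push_cast
      ring
    have hn0 : 0 ≤ n := le_trans (by positivity) hn
    calc c ^ 2 / 12 * (r N) ^ 4 = (N : ℝ) / 12 * (c * (N : ℝ) ^ k) ^ 2 * q ^ 4 := by
          rw [hrq, mul_pow, h4]; ring
      _ ≤ _ := by gcongr
  have e1 : 2 / n ≤ 24 * (N : ℝ)⁻¹ := by
    calc 2 / n ≤ 2 / ((N : ℝ) / 12) := by gcongr
      _ = _ := by field_simp; norm_num
  have e2 : 2 / (n * m ^ 2 * q ^ 4) ≤ 24 / c ^ 2 * ((r N)⁻¹) ^ 4 := by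
    calc 2 / (n * m ^ 2 * q ^ 4) ≤ 2 / (c ^ 2 / 12 * (r N) ^ 4) := by gcongr
      _ = _ := by field_simp; norm_num
  have e3 : 4 / (m * q) ≤ 4 / c * (r N)⁻¹ := by
    calc 4 / (m * q) ≤ 4 / (c * r N) := by gcongr
      _ = _ := by field_simp
  have e4 : 4 / (m * q) ^ 2 ≤ 4 / c ^ 2 * ((r N)⁻¹) ^ 2 := by
    calc 4 / (m * q) ^ 2 ≤ 4 / (c * r N) ^ 2 := by gcongr
      _ = _ := by field_simp
  linarith

end SecondMoment

theorem theorem3 (k : ℕ) (hk : 2 ≤ k) (p : ℕ → unitInterval) :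
    (((fun N : ℕ => (p N : ℝ)) =o[Filter.atTop]
        (fun N : ℕ => (N : ℝ) ^ (-((2 * (k : ℝ) + 1) / 4)))) →
      Filter.Tendsto (fun N : ℕ => (randomSystem N k (p N)).real sidonEvent)
        Filter.atTop (nhds 1)) ∧
    (((fun N : ℕ => (N : ℝ) ^ (-((2 * (k : ℝ) + 1) / 4))) =o[Filter.atTop]
        (fun N : ℕ => (p N : ℝ))) →
      Filter.Tendsto (fun N : ℕ => (randomSystem N k (p N)).real sidonEvent)
        Filter.atTop (nhds 0)) :=
  ⟨tendsto_randomSystem_real_sidonEvent_one hk p,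
    tendsto_randomSystem_real_sidonEvent_zero (by omega) p⟩
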